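/- Let $Q_8=\{\pm1,\pm i,\pm j,\pm k\}$ be the quaternion group and let $1\to Q_8\to G'\xrightarrow{q} G\to 1$ be a short exact sequence of groups. Let $d\ge 2$ and let $\alpha_i,\beta_i\in G$, $1\le i\le d$, be such that $\prod_{i=1}^d[\alpha_i,\beta_i]=1$ (ordered product, $[x,y]=xyx^{-1}y^{-1}$). Then there is a family $\{a_i,b_i\}_{i=1}^d$ of elements of $G'$ such that $q(a_i)=\alpha_i$ and $q(b_i)=\beta_i$ for all $i$ and $\prod_{i=1}^d[a_i,b_i]=1$. The number of such families is finite and is equal to $8^{2d-1}(N+2^{2-2d})$ or to $8^{2d-1}(N-2^{2-2d})$ for some $N\in\{1,2,4\}$. -/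

import Mathlib

/-- The ordered product `[a₁, b₁] [a₂, b₂] ⋯ [a_d, b_d]` of commutators in a group,
where `[x, y] = x y x⁻¹ y⁻¹`. -/
def commutatorProd {H : Type*} [Group H] {d : ℕ} (a b : Fin d → H) : H :=
  (List.ofFn fun i => a i * b i * (a i)⁻¹ * (b i)⁻¹).prod

/-- The families `(aᵢ, bᵢ)` in `H` lifting `(αᵢ, βᵢ)` along `q`, whose ordered product of
commutators is trivial. -/
def commutatorLifts {H K : Type*} [Group H] [Group K] (q : H →* K) {d : ℕ}
    (α β : Fin d → K) : Set ((Fin d → H) × (Fin d → H)) :=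
  {p | (∀ i, q (p.1 i) = α i) ∧ (∀ i, q (p.2 i) = β i) ∧ commutatorProd p.1 p.2 = 1}

open scoped Quaternion

namespace QuaternionGroup

/-! ### The embedding of `Q₈` into the rational quaternions -/

/-! Choose lifts `A`, `B` whose commutator product `P` is `±1` in `Q₈`. Every other lift has the
form `x i * A i`, `y i * B i`, and its commutator product is `commutatorDefect x y * P`. Let `n₊`
and `n₋` count the pairs `(x, y)` for which this is `1` and `-1`; `n₊` is the number sought.

Modulo the center the defect is a homomorphism from `Q₈^(2d)` to the Klein four-group, so `n₊ + n₋ =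
64^d * N / 4` (`card_commutatorDefect_central`).

The real part is `1` at `1`, `-1` at `-1` and `0` elsewhere on `Q₈`, so `n₊ - n₋` is a sum of real
parts of quaternions. Automorphisms of `Q₈` are conjugations by quaternions `u`, `v`, and the
commutators `[x u, y v]` over all `x, y ∈ Q₈` sum to the scalar `16` (`sum_sum_commutator`). By
induction on `d`, `n₊ - n₋ = ±16^d` (`card_commutatorDefect_sub`).

Hence `n₊ = 64^d * N / 8 ± 16^d / 2`, which is positive for `d ≥ 2`. -/

theorem sum_two {M : Type*} [AddCommMonoid M] (f : QuaternionGroup 2 → M) :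
    ∑ x, f x = f (a 0) + f (a 1) + f (a 2) + f (a 3) +
      f (xa 0) + f (xa 1) + f (xa 2) + f (xa 3) := by
  have h : (Finset.univ : Finset (QuaternionGroup 2)) =
      {a 0, a 1, a 2, a 3, xa 0, xa 1, xa 2, xa 3} := by decide
  rw [h]
  repeat rw [Finset.sum_insert (by decide)]
  rw [Finset.sum_singleton]
  simp only [add_assoc]

/-- The coordinates of an element of `Q₈` in the basis `1, i, j, k` of the quaternions, where
`i = a 1`, `j = xa 0` and `k = xa 3`. -/
def coord : QuaternionGroup 2 → Fin 4 → ℤ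
  | a k => (![![1, 0, 0, 0], ![0, 1, 0, 0], ![-1, 0, 0, 0], ![0, -1, 0, 0]] :
      Fin 4 → Fin 4 → ℤ) k
  | xa k => (![![0, 0, 1, 0], ![0, 0, 0, -1], ![0, 0, -1, 0], ![0, 0, 0, 1]] :
      Fin 4 → Fin 4 → ℤ) k

theorem coord_mul : ∀ x y : QuaternionGroup 2,
    coord (x * y) 0 = coord x 0 * coord y 0 - coord x 1 * coord y 1
      - coord x 2 * coord y 2 - coord x 3 * coord y 3 ∧
    coord (x * y) 1 = coord x 0 * coord y 1 + coord x 1 * coord y 0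
      + coord x 2 * coord y 3 - coord x 3 * coord y 2 ∧
    coord (x * y) 2 = coord x 0 * coord y 2 - coord x 1 * coord y 3
      + coord x 2 * coord y 0 + coord x 3 * coord y 1 ∧
    coord (x * y) 3 = coord x 0 * coord y 3 + coord x 1 * coord y 2
      - coord x 2 * coord y 1 + coord x 3 * coord y 0 := by
  decide

/-- The rational quaternion with the coordinates of an element of `Q₈`. -/
def toQuaternionFun (x : QuaternionGroup 2) : ℍ[ℚ] :=
  ⟨coord x 0, coord x 1, coord x 2, coord x 3⟩

theorem re_toQuaternionFun (x : QuaternionGroup 2) : (toQuaternionFun x).re = coord x 0 := rfl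

theorem imI_toQuaternionFun (x : QuaternionGroup 2) : (toQuaternionFun x).imI = coord x 1 := rfl

theorem imJ_toQuaternionFun (x : QuaternionGroup 2) : (toQuaternionFun x).imJ = coord x 2 := rfl

theorem imK_toQuaternionFun (x : QuaternionGroup 2) : (toQuaternionFun x).imK = coord x 3 := rfl

/-- The embedding of `Q₈` into the rational quaternions. -/
def toQuaternion : QuaternionGroup 2 →* ℍ[ℚ] where
  toFun := toQuaternionFun
  map_one' := by
    have h : coord 1 0 = 1 ∧ coord 1 1 = 0 ∧ coord 1 2 = 0 ∧ coord 1 3 = 0 := by decide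
    obtain ⟨h0, h1, h2, h3⟩ := h
    ext <;> simp [re_toQuaternionFun, imI_toQuaternionFun, imJ_toQuaternionFun,
      imK_toQuaternionFun, h0, h1, h2, h3]
  map_mul' x y := by
    obtain ⟨h0, h1, h2, h3⟩ := coord_mul x y
    ext <;> simp [re_toQuaternionFun, imI_toQuaternionFun, imJ_toQuaternionFun,
      imK_toQuaternionFun, h0, h1, h2, h3]

@[simp]
theorem re_toQuaternion (x : QuaternionGroup 2) : (toQuaternion x).re = coord x 0 := rfl

@[simp]
theorem imI_toQuaternion (x : QuaternionGroup 2) : (toQuaternion x).imI = coord x 1 := rfl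

@[simp]
theorem imJ_toQuaternion (x : QuaternionGroup 2) : (toQuaternion x).imJ = coord x 2 := rfl

@[simp]
theorem imK_toQuaternion (x : QuaternionGroup 2) : (toQuaternion x).imK = coord x 3 := rfl

theorem normSq_toQuaternion (x : QuaternionGroup 2) :
    Quaternion.normSq (toQuaternion x) = 1 := by
  have h : ∀ x, coord x 0 ^ 2 + coord x 1 ^ 2 + coord x 2 ^ 2 + coord x 3 ^ 2 = 1 := by decide
  rw [Quaternion.normSq_def', re_toQuaternion, imI_toQuaternion, imJ_toQuaternion,
    imK_toQuaternion]
  exact_mod_cast h x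

theorem toQuaternion_ne_zero (x : QuaternionGroup 2) : toQuaternion x ≠ 0 := by
  rw [← Quaternion.normSq_ne_zero, normSq_toQuaternion]
  exact one_ne_zero

theorem toQuaternion_inv (x : QuaternionGroup 2) :
    toQuaternion x⁻¹ = (toQuaternion x)⁻¹ := by
  refine eq_inv_of_mul_eq_one_left ?_
  rw [← map_mul, inv_mul_cancel, map_one]

theorem coord_values :
    (coord (a 0) = ![1, 0, 0, 0] ∧ coord (a 1) = ![0, 1, 0, 0] ∧
      coord (a 2) = ![-1, 0, 0, 0] ∧ coord (a 3) = ![0, -1, 0, 0]) ∧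
    (coord (xa 0) = ![0, 0, 1, 0] ∧ coord (xa 1) = ![0, 0, 0, -1] ∧
      coord (xa 2) = ![0, 0, -1, 0] ∧ coord (xa 3) = ![0, 0, 0, 1]) := by
  decide

theorem inv_values :
    ((a 0 : QuaternionGroup 2)⁻¹ = a 0 ∧ (a 1 : QuaternionGroup 2)⁻¹ = a 3 ∧
      (a 2 : QuaternionGroup 2)⁻¹ = a 2 ∧ (a 3 : QuaternionGroup 2)⁻¹ = a 1) ∧
    ((xa 0 : QuaternionGroup 2)⁻¹ = xa 2 ∧ (xa 1 : QuaternionGroup 2)⁻¹ = xa 3 ∧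
      (xa 2 : QuaternionGroup 2)⁻¹ = xa 0 ∧ (xa 3 : QuaternionGroup 2)⁻¹ = xa 1) := by
  decide

/-- Averaging over the conjugates by `Q₈` is the projection to the real part. -/
theorem sum_conj_toQuaternion (z : ℍ[ℚ]) :
    ∑ x, toQuaternion x * z * (toQuaternion x)⁻¹ = (8 * z.re) • (1 : ℍ[ℚ]) := by
  obtain ⟨⟨c0, c1, c2, c3⟩, d0, d1, d2, d3⟩ := coord_values
  obtain ⟨⟨i0, i1, i2, i3⟩, j0, j1, j2, j3⟩ := inv_values
  simp only [← toQuaternion_inv]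
  rw [sum_two, i0, i1, i2, i3, j0, j1, j2, j3]
  ext <;> (simp [c0, c1, c2, c3, d0, d1, d2, d3, -a_zero]; try ring)

/-- The conjugates of the `y` run twice, up to sign, through an orthonormal basis, and `re (y v)` is
the coordinate of `v` along `star y`. So the sum is `star v * (2 v)`. -/
theorem sum_re_mul_star (v : ℍ[ℚ]) :
    ∑ y, (toQuaternion y * v).re • star (toQuaternion y * v) =
      (2 * Quaternion.normSq v) • (1 : ℍ[ℚ]) := by
  obtain ⟨⟨c0, c1, c2, c3⟩, d0, d1, d2, d3⟩ := coord_values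
  rw [sum_two, Quaternion.normSq_def']
  ext <;> (simp [c0, c1, c2, c3, d0, d1, d2, d3, -a_zero]; ring)

theorem _root_.Quaternion.re_conj {u : ℍ[ℚ]} (hu : u ≠ 0) (z : ℍ[ℚ]) :
    (u * z * u⁻¹).re = z.re := by
  have h : ∀ p q : ℍ[ℚ], (p * q).re = (q * p).re := fun p q => by
    simp only [Quaternion.re_mul]; ring
  rw [h, inv_mul_cancel_left₀ hu]

/-- The sum of the commutators of two cosets of `Q₈` in the unit group of the quaternions. -/
theorem sum_sum_commutator {u v : ℍ[ℚ]} (hu : u ≠ 0) (hv : v ≠ 0) :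
    ∑ x, ∑ y, toQuaternion x * u * (toQuaternion y * v) * (toQuaternion x * u)⁻¹ *
      (toQuaternion y * v)⁻¹ = (16 : ℚ) • (1 : ℍ[ℚ]) := by
  -- The sum over `x` averages the conjugates of `u (y v) u⁻¹`, which has the same real part as `y
  -- v`.
  have h1 : ∀ y, ∑ x, toQuaternion x * u * (toQuaternion y * v) * (toQuaternion x * u)⁻¹ *
      (toQuaternion y * v)⁻¹ = (8 * (toQuaternion y * v).re) •
        (toQuaternion y * v)⁻¹ := fun y => by
    rw [← one_mul (toQuaternion y * v)⁻¹, ← smul_mul_assoc, ← Quaternion.re_conj hu,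
      ← sum_conj_toQuaternion, Finset.sum_mul]
    simp only [mul_inv_rev, mul_assoc, one_mul]
  have h2 : ∀ y, (8 * (toQuaternion y * v).re) • (toQuaternion y * v)⁻¹ =
      (8 * (Quaternion.normSq v)⁻¹) •
        ((toQuaternion y * v).re • star (toQuaternion y * v)) := fun y => by
    rw [Quaternion.inv_def, map_mul, normSq_toQuaternion, one_mul, smul_smul, smul_smul]
    congr 1
    ring
  have hv' := Quaternion.normSq_ne_zero.2 hv
  rw [Finset.sum_comm]
  simp only [h1, h2]
  rw [← Finset.smul_sum, sum_re_mul_star, smul_smul]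
  congr 1
  field_simp
  norm_num

theorem map_a_two (φ : MulAut (QuaternionGroup 2)) : φ (a 2) = a 2 := by
  have h : ∀ p : QuaternionGroup 2, p * p = 1 → p ≠ 1 → p = a 2 := by decide
  refine h _ ?_ ?_
  · rw [← map_mul, show (a 2 * a 2 : QuaternionGroup 2) = 1 by decide, map_one]
  · rw [Ne, map_eq_one_iff φ φ.injective]
    decide

/-- Every automorphism of `Q₈` is induced by conjugation with a quaternion. -/
theorem exists_quaternion_conj (φ : MulAut (QuaternionGroup 2)) :
    ∃ u : ℍ[ℚ], u ≠ 0 ∧ ∀ g, toQuaternion (φ g) * u = u * toQuaternion g := by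
  -- Averaging makes every `U t` an intertwiner, so it suffices that some `U t` is nonzero.
  let U : ℍ[ℚ] → ℍ[ℚ] := fun t => ∑ x, toQuaternion (φ x) * t * (toQuaternion x)⁻¹
  have hU : ∀ t g, toQuaternion (φ g) * U t = U t * toQuaternion g := by
    intro t g
    simp only [U, Finset.mul_sum, Finset.sum_mul]
    rw [← Equiv.sum_comp (Equiv.mulLeft g) (fun x =>
      toQuaternion (φ x) * t * (toQuaternion x)⁻¹ * toQuaternion g)]
    refine Finset.sum_congr rfl fun x _ => ?_
    simp only [Equiv.coe_mulLeft, map_mul, mul_inv_rev, mul_assoc,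
      inv_mul_cancel₀ (toQuaternion_ne_zero g), mul_one]
  by_contra! hne
  have h0 : ∀ t, U t = 0 := fun t => by
    by_contra h
    obtain ⟨g, hg⟩ := hne _ h
    exact hg (hU t g)
  -- Summing over `t` first leaves `∑ φ(x) * 8 re(x⁻¹)`. Only `x = ±1` contribute, each giving `8`
  -- because `φ` fixes `-1`.
  have h1 : ∑ t, U (toQuaternion t) * (toQuaternion t)⁻¹ = (16 : ℚ) • (1 : ℍ[ℚ]) := by
    simp only [U, Finset.sum_mul]
    rw [Finset.sum_comm]
    have h2 : ∀ x, ∑ t, toQuaternion (φ x) * toQuaternion t * (toQuaternion x)⁻¹ *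
        (toQuaternion t)⁻¹ = toQuaternion (φ x) * (8 * (toQuaternion x⁻¹).re) • (1 : ℍ[ℚ]) := by
      intro x
      rw [← sum_conj_toQuaternion, Finset.mul_sum]
      refine Finset.sum_congr rfl fun t _ => ?_
      rw [toQuaternion_inv]
      simp only [mul_assoc]
    simp only [h2]
    obtain ⟨⟨c0, c1, c2, c3⟩, d0, d1, d2, d3⟩ := coord_values
    obtain ⟨⟨i0, i1, i2, i3⟩, j0, j1, j2, j3⟩ := inv_values
    rw [sum_two, i0, i1, i2, i3, j0, j1, j2, j3, map_a_two,
      show φ (a 0) = a 0 from map_one φ]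
    have h3 : toQuaternion (a 2) = (-1 : ℚ) • (1 : ℍ[ℚ]) := by ext <;> simp [c2]
    have h4 : toQuaternion (a 0) = 1 := map_one _
    simp only [h3, h4, re_toQuaternion, c1, c3, d0, d1, d2, d3, Matrix.cons_val, Int.cast_zero,
      mul_zero, zero_smul, add_zero, Quaternion.re_smul, Quaternion.re_one, mul_one,
      smul_eq_mul, mul_smul_comm, smul_smul, ← add_smul]
    norm_num
  simp only [h0, zero_mul, Finset.sum_const_zero] at h1
  exact smul_ne_zero (by norm_num) one_ne_zero h1.symm

/-- A quaternion of norm one that commutes with `Q₈` is `1` or `-1`. -/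
theorem eq_one_or_neg_one_of_commute {c : ℍ[ℚ]} (hc : Quaternion.normSq c = 1)
    (h : ∀ g, toQuaternion g * c = c * toQuaternion g) : c = 1 ∨ c = -1 := by
  obtain ⟨⟨-, c1, -, -⟩, d0, -, -, -⟩ := coord_values
  have hi := h (a 1)
  have hj := h (xa 0)
  have hi2 := congrArg QuaternionAlgebra.imJ hi
  have hi3 := congrArg QuaternionAlgebra.imK hi
  have hj3 := congrArg QuaternionAlgebra.imK hj
  simp [c1, d0] at hi2 hi3 hj3
  have e1 : c.imI = 0 := by linarith
  have e2 : c.imJ = 0 := by linarith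
  have e3 : c.imK = 0 := by linarith
  rw [Quaternion.normSq_def', e1, e2, e3] at hc
  rcases (sq_eq_sq_iff_eq_or_eq_neg (b := (1 : ℚ))).1 (by linarith : c.re ^ 2 = 1 ^ 2) with h | h
  · left; ext <;> simp [h, e1, e2, e3]
  · right; ext <;> simp [h, e1, e2, e3]

end QuaternionGroup
/-! ### Ordered products of commutators -/

theorem commutatorProd_succ {H : Type*} [Group H] {d : ℕ} (a b : Fin (d + 1) → H) :
    commutatorProd a b = a 0 * b 0 * (a 0)⁻¹ * (b 0)⁻¹ *
      commutatorProd (fun i : Fin d => a i.succ) (fun i : Fin d => b i.succ) := by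
  simp [commutatorProd, List.ofFn_succ]

theorem map_commutatorProd {H K : Type*} [Group H] [Group K] (f : H →* K) {d : ℕ}
    (a b : Fin d → H) :
    f (commutatorProd a b) = commutatorProd (fun i => f (a i)) (fun i => f (b i)) := by
  simp [commutatorProd, map_list_prod, List.map_ofFn, Function.comp_def]

theorem commutatorProd_mem {H : Type*} [Group H] (K : Subgroup H) {d : ℕ} {a b : Fin d → H}
    (ha : ∀ i, a i ∈ K) (hb : ∀ i, b i ∈ K) : commutatorProd a b ∈ K := by
  refine K.list_prod_mem fun x hx => ?_
  obtain ⟨i, rfl⟩ := (List.mem_ofFn' _ _).1 hx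
  exact K.mul_mem (K.mul_mem (K.mul_mem (ha i) (hb i)) (K.inv_mem (ha i))) (K.inv_mem (hb i))

/-! ### The change of a commutator product under a change of lifts -/

section Defect

variable {Q E : Type*} [Group Q] [Group E] (φ : E →* MulAut Q)

/-- The factor by which the ordered product of commutators changes when the families `A`, `B` are
multiplied from the left with families `x`, `y` in a normal subgroup `Q`, on which the ambient
group acts through `φ`. -/
def commutatorDefect {d : ℕ} (A B : Fin d → E) (x y : Fin d → Q) : Q :=
  (commutatorProd (fun i => (⟨x i, A i⟩ : Q ⋊[φ] E)) (fun i => ⟨y i, B i⟩)).left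

theorem right_commutatorProd {d : ℕ} (A B : Fin d → E) (x y : Fin d → Q) :
    (commutatorProd (fun i => (⟨x i, A i⟩ : Q ⋊[φ] E)) (fun i => ⟨y i, B i⟩)).right =
      commutatorProd A B :=
  map_commutatorProd SemidirectProduct.rightHom _ _

theorem commutatorDefect_succ {d : ℕ} (A B : Fin (d + 1) → E) (x y : Fin (d + 1) → Q) :
    commutatorDefect φ A B x y =
      x 0 * φ (A 0) (y 0) * φ (A 0 * B 0 * (A 0)⁻¹) (x 0)⁻¹ *
        φ (A 0 * B 0 * (A 0)⁻¹ * (B 0)⁻¹) (y 0)⁻¹ *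
      φ (A 0 * B 0 * (A 0)⁻¹ * (B 0)⁻¹) (commutatorDefect φ (fun i => A i.succ)
        (fun i => B i.succ) (fun i => x i.succ) (fun i => y i.succ)) := by
  simp [commutatorDefect, commutatorProd_succ, mul_assoc]

/-- In an abelian quotient, the defect is multiplicative. -/
theorem map_commutatorDefect_mul {V : Type*} [CommGroup V] (p : Q →* V) {d : ℕ}
    (A B : Fin d → E) (κ : MulAut Q) (x x' y y' : Fin d → Q) :
    p (κ (commutatorDefect φ A B (x * x') (y * y'))) =
      p (κ (commutatorDefect φ A B x y)) * p (κ (commutatorDefect φ A B x' y')) := by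
  -- `p` need not be compatible with the action, so `κ` absorbs the automorphism that the recursion
  -- applies to the tail.
  induction d generalizing κ with
  | zero => simp [commutatorDefect, commutatorProd]
  | succ d ih =>
    have h := ih (fun i => A i.succ) (fun i => B i.succ)
      (κ * φ (A 0 * B 0 * (A 0)⁻¹ * (B 0)⁻¹)) (fun i => x i.succ) (fun i => x' i.succ)
      (fun i => y i.succ) (fun i => y' i.succ)
    simp only [MulAut.mul_apply] at h
    rw [commutatorDefect_succ, commutatorDefect_succ, commutatorDefect_succ]
    have hm : ∀ g g', p (κ (g * g')) = p (κ g) * p (κ g') := fun g g' => by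
      rw [map_mul κ, map_mul p]
    have hr : ∀ a b c e f a' b' c' e' f' : V,
        a * a' * (b * b') * (c' * c) * (e' * e) * (f * f') =
          a * b * c * e * f * (a' * b' * c' * e' * f') := fun a b c e f a' b' c' e' f' => by
      rw [mul_comm c', mul_comm e', mul_mul_mul_comm a, mul_mul_mul_comm (a * b),
        mul_mul_mul_comm (a * b * c), mul_mul_mul_comm (a * b * c * e)]
    generalize hD : commutatorDefect φ (fun i => A i.succ) (fun i => B i.succ)
      (fun i => (x * x') i.succ) (fun i => (y * y') i.succ) = D
    have hD' : p (κ (φ (A 0 * B 0 * (A 0)⁻¹ * (B 0)⁻¹) D)) = _ := hD ▸ h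
    simp only [hm, hD', Pi.mul_apply, mul_inv_rev, map_mul (φ _)]
    exact hr _ _ _ _ _ _ _ _ _ _

/-- Since `S` becomes conjugation under `j`, the map `(n, e) ↦ j n * e` is a homomorphism on the
semidirect product. -/
theorem lift_commutatorDefect (S : E →* MulAut Q) (j : Q →* E)
    (hj : ∀ e n, j (S e n) = e * j n * e⁻¹) {d : ℕ} (A B : Fin d → E) (x y : Fin d → Q) :
    commutatorProd (fun i => j (x i) * A i) (fun i => j (y i) * B i) =
      j (commutatorDefect S A B x y) * commutatorProd A B := by
  let F : Q ⋊[S] E →* E := SemidirectProduct.lift j (MonoidHom.id E) (fun e => by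
    ext n
    simp [hj])
  have h := map_commutatorProd F (fun i => (⟨x i, A i⟩ : Q ⋊[S] E)) (fun i => ⟨y i, B i⟩)
  rw [← right_commutatorProd S A B x y]
  exact h.symm

end Defect

/-! ### The quaternion sum of all defects -/

namespace QuaternionGroup

/-- The embedding of `Q₈` into the unit group of the rational quaternions. -/
noncomputable def toQuaternionUnits : QuaternionGroup 2 →* ℍ[ℚ]ˣ := toQuaternion.toHomUnits

@[simp]
theorem coe_toQuaternionUnits (x : QuaternionGroup 2) :
    (toQuaternionUnits x : ℍ[ℚ]) = toQuaternion x := rfl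

theorem exists_unit_conj (φ : MulAut (QuaternionGroup 2)) :
    ∃ u : ℍ[ℚ]ˣ, ∀ g, toQuaternionUnits (φ g) = u * toQuaternionUnits g * u⁻¹ := by
  obtain ⟨u, hu, h⟩ := exists_quaternion_conj φ
  refine ⟨Units.mk0 u hu, fun g => ?_⟩
  rw [eq_mul_inv_iff_mul_eq]
  exact Units.ext (h g)

theorem unit_conj_inv {φ : MulAut (QuaternionGroup 2)} {u : ℍ[ℚ]ˣ}
    (h : ∀ g, toQuaternionUnits (φ g) = u * toQuaternionUnits g * u⁻¹) (g) :
    toQuaternionUnits (φ⁻¹ g) = u⁻¹ * toQuaternionUnits g * u := by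
  have := h (φ⁻¹ g)
  rw [MulAut.apply_inv_self] at this
  rw [this]
  group

/-- The sum of the commutator defects, as a rational quaternion. -/
theorem sum_commutatorDefect {E : Type*} [Group E] (φ : E →* MulAut (QuaternionGroup 2)) {d : ℕ}
    (A B : Fin d → E) :
    ∃ c : ℍ[ℚ]ˣ, Quaternion.normSq (c : ℍ[ℚ]) = 1 ∧
      (∀ g, toQuaternionUnits (φ (commutatorProd A B) g) = c * toQuaternionUnits g * c⁻¹) ∧
      ∑ x, ∑ y, toQuaternion (commutatorDefect φ A B x y) =
        (16 ^ d : ℚ) • ((c⁻¹ : ℍ[ℚ]ˣ) : ℍ[ℚ]) := by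
  induction d with
  | zero =>
    refine ⟨1, by simp, fun g => ?_, ?_⟩
    · simp [commutatorProd]
    · simp [commutatorDefect, commutatorProd]
  | succ d ih =>
    obtain ⟨c, hc, hcg, hsum⟩ := ih (fun i => A i.succ) (fun i => B i.succ)
    obtain ⟨u, hu⟩ := exists_unit_conj (φ (A 0))
    obtain ⟨v, hv⟩ := exists_unit_conj (φ (B 0))
    have hui := unit_conj_inv hu
    have hvi := unit_conj_inv hv
    have h0 : ∀ g, toQuaternionUnits (φ (A 0 * B 0 * (A 0)⁻¹ * (B 0)⁻¹) g) =
        (u * v * u⁻¹ * v⁻¹) * toQuaternionUnits g * (u * v * u⁻¹ * v⁻¹)⁻¹ := fun g => by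
      simp only [map_mul, map_inv, MulAut.mul_apply, hu, hv, hui, hvi]
      group
    -- `u` and `v` need not have norm one, but their commutator does.
    refine ⟨u * v * u⁻¹ * v⁻¹ * c, ?_, fun g => ?_, ?_⟩
    · simp only [Units.val_mul, Units.val_inv_eq_inv_val, map_mul, map_inv₀, hc]
      have h1 := Quaternion.normSq_ne_zero.2 u.ne_zero
      have h2 := Quaternion.normSq_ne_zero.2 v.ne_zero
      field_simp
    · rw [commutatorProd_succ, map_mul φ, MulAut.mul_apply, h0, hcg]
      group
    -- The defect factors as `[x0 u, y0 v] * D * [u, v]⁻¹` with `D` the defect of the tail, so the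
    -- sums over the head and the tail separate.
    · have h1 : ∀ (x0 y0 : QuaternionGroup 2) (x y : Fin d → QuaternionGroup 2),
          toQuaternion (commutatorDefect φ A B (Fin.cons x0 x : Fin (d + 1) → QuaternionGroup 2)
            (Fin.cons y0 y : Fin (d + 1) → QuaternionGroup 2)) =
          (toQuaternion x0 * u * (toQuaternion y0 * v) * (toQuaternion x0 * u)⁻¹ *
            (toQuaternion y0 * v)⁻¹) *
          (toQuaternion (commutatorDefect φ (fun i => A i.succ) (fun i => B i.succ) x y) *
            ((u * v * u⁻¹ * v⁻¹)⁻¹ : ℍ[ℚ]ˣ)) := by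
        intro x0 y0 x y
        have h2 : toQuaternionUnits (commutatorDefect φ A B
            (Fin.cons x0 x : Fin (d + 1) → QuaternionGroup 2)
            (Fin.cons y0 y : Fin (d + 1) → QuaternionGroup 2)) =
          (toQuaternionUnits x0 * u * (toQuaternionUnits y0 * v) * (toQuaternionUnits x0 * u)⁻¹ *
            (toQuaternionUnits y0 * v)⁻¹) *
          (toQuaternionUnits (commutatorDefect φ (fun i => A i.succ) (fun i => B i.succ) x y) *
            (u * v * u⁻¹ * v⁻¹)⁻¹) := by
          rw [commutatorDefect_succ]
          simp only [Fin.cons_zero, Fin.cons_succ, map_mul toQuaternionUnits, h0]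
          simp only [map_mul, map_inv, MulAut.mul_apply, hu, hv, hui]
          group
        have h3 := congrArg (Units.val) h2
        simpa only [Units.val_mul, coe_toQuaternionUnits, Units.val_inv_eq_inv_val] using h3
      rw [← (Fin.consEquiv (fun _ => QuaternionGroup 2)).sum_comp, Fintype.sum_prod_type]
      simp only [← (Fin.consEquiv (fun _ => QuaternionGroup 2)).sum_comp (fun y =>
        toQuaternion (commutatorDefect φ A B _ y)), Fintype.sum_prod_type]
      simp only [Fin.consEquiv, Equiv.coe_fn_mk, h1]
      simp only [← Finset.mul_sum, ← Finset.sum_mul]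
      rw [sum_sum_commutator u.ne_zero v.ne_zero, hsum, mul_inv_rev _ c, Units.val_mul, pow_succ']
      simp only [smul_mul_assoc, one_mul, smul_smul]

end QuaternionGroup
namespace QuaternionGroup

/-! ### A complement of the inner automorphisms of `Q₈` -/

/-- Two elements of `Q₈` lie both in `{i, j, k}` or both in `{-i, -j, -k}`. -/
def SameSign (p q : QuaternionGroup 2) : Prop :=
  (p ∈ ({a 1, xa 0, xa 3} : Finset (QuaternionGroup 2)) ∧
    q ∈ ({a 1, xa 0, xa 3} : Finset (QuaternionGroup 2))) ∨
  (p⁻¹ ∈ ({a 1, xa 0, xa 3} : Finset (QuaternionGroup 2)) ∧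
    q⁻¹ ∈ ({a 1, xa 0, xa 3} : Finset (QuaternionGroup 2)))

instance (p q : QuaternionGroup 2) : Decidable (SameSign p q) := by
  unfold SameSign
  infer_instance

/-- The automorphisms of `Q₈` that permute the sets `{i, j, k}` and `{-i, -j, -k}`. -/
def signSubgroup : Subgroup (MulAut (QuaternionGroup 2)) where
  carrier := {φ | ∀ p q, SameSign (φ p) (φ q) ↔ SameSign p q}
  one_mem' _ _ := Iff.rfl
  mul_mem' hφ hψ p q := (hφ _ _).trans (hψ p q)
  inv_mem' {φ} hφ p q := by
    have := hφ (φ⁻¹ p) (φ⁻¹ q)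
    rw [MulAut.apply_inv_self, MulAut.apply_inv_self] at this
    exact this.symm

/-- The image of an element of `Q₈` under the homomorphism with `i ↦ p` and `j ↦ q`. -/
def word (p q : QuaternionGroup 2) : QuaternionGroup 2 → QuaternionGroup 2
  | a k => p ^ (show Fin 4 from k).val
  | xa k => q * p ^ (show Fin 4 from k).val

theorem map_word (φ : MulAut (QuaternionGroup 2)) (p q g : QuaternionGroup 2) :
    φ (word p q g) = word (φ p) (φ q) g := by
  cases g <;> simp [word]

theorem apply_eq_word (φ : MulAut (QuaternionGroup 2)) (g : QuaternionGroup 2) :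
    φ g = word (φ (a 1)) (φ (xa 0)) g := by
  have h : ∀ g, word (a 1) (xa 0) g = g := by decide
  rw [← map_word, h]

theorem mem_signSubgroup {φ : MulAut (QuaternionGroup 2)}
    (h1 : SameSign (φ (a 1)) (φ (xa 0))) (h2 : SameSign (φ (a 1)) (φ (a 1) * φ (xa 0))) :
    φ ∈ signSubgroup := by
  -- An automorphism is encoded by the images `p`, `q` of `i`, `j`, which reduces the claim to a
  -- finite check.
  have h : ∀ p q, SameSign p q → SameSign p (p * q) → ∀ g h,
      (SameSign (word p q g) (word p q h) ↔ SameSign g h) := by decide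
  intro g g'
  rw [apply_eq_word φ g, apply_eq_word φ g']
  exact h _ _ h1 h2 g g'

/-- Conjugation by `i`, `j` or `k` flips the signs on exactly two of the three axes, so the signs of
the images of `i`, `j`, `k` can be made equal. -/
theorem exists_conj_mul_mem_signSubgroup (φ : MulAut (QuaternionGroup 2)) :
    ∃ x, MulAut.conj x * φ ∈ signSubgroup := by
  have h : ∀ p q : QuaternionGroup 2, p * q ≠ q * p → ∃ x, SameSign (x * p * x⁻¹) (x * q * x⁻¹) ∧
      SameSign (x * p * x⁻¹) (x * p * x⁻¹ * (x * q * x⁻¹)) := by decide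
  obtain ⟨x, h1, h2⟩ := h (φ (a 1)) (φ (xa 0)) (by
    rw [← map_mul, ← map_mul, Ne, φ.injective.eq_iff]
    decide)
  exact ⟨x, mem_signSubgroup h1 h2⟩

theorem eq_one_or_eq_a_two_of_conj_mem {p : QuaternionGroup 2}
    (h : MulAut.conj p ∈ signSubgroup) : p = 1 ∨ p = a 2 := by
  have h' : ∀ p : QuaternionGroup 2, SameSign (p * a 1 * p⁻¹) (p * xa 0 * p⁻¹) →
      SameSign (p * a 1 * p⁻¹) (p * xa 3 * p⁻¹) → p = 1 ∨ p = a 2 := by decide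
  exact h' p ((h (a 1) (xa 0)).2 (by decide)) ((h (a 1) (xa 3)).2 (by decide))

/-- The quotient map of `Q₈` by its center. -/
def toKlein : QuaternionGroup 2 →* Multiplicative (ZMod 2 × ZMod 2) where
  toFun
    | a k => Multiplicative.ofAdd (((show Fin 4 from k).val : ZMod 2), 0)
    | xa k => Multiplicative.ofAdd (((show Fin 4 from k).val : ZMod 2), 1)
  map_one' := by decide
  map_mul' := by decide

theorem toKlein_eq_one_iff : ∀ g : QuaternionGroup 2, toKlein g = 1 ↔ g = 1 ∨ g = a 2 := by
  decide

theorem coord_zero_eq : ∀ g : QuaternionGroup 2,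
    coord g 0 = (if g = 1 then 1 else 0) - (if g = a 2 then 1 else 0) := by
  decide

/-! ### Counting the values of the defect -/

section Count

variable {E : Type*} [Group E] (φ : E →* MulAut (QuaternionGroup 2)) {d : ℕ} (A B : Fin d → E)

/-- The number of central values of the defect. -/
theorem card_commutatorDefect_central :
    ∃ N ∈ ({1, 2, 4} : Set ℕ),
      4 * (Finset.univ.filter fun p : (Fin d → QuaternionGroup 2) × (Fin d → QuaternionGroup 2) =>
        commutatorDefect φ A B p.1 p.2 = 1 ∨ commutatorDefect φ A B p.1 p.2 = a 2).card =
      64 ^ d * N := by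
  let L : (Fin d → QuaternionGroup 2) × (Fin d → QuaternionGroup 2) →*
      Multiplicative (ZMod 2 × ZMod 2) :=
    MonoidHom.mk' (fun p => toKlein (commutatorDefect φ A B p.1 p.2))
      fun p q => map_commutatorDefect_mul φ toKlein A B 1 p.1 q.1 p.2 q.2
  have h1 : Nat.card L.ker * Nat.card L.range = 64 ^ d := by
    rw [← Subgroup.index_ker, Subgroup.card_mul_index, Nat.card_prod, Nat.card_fun,
      Nat.card_eq_fintype_card, QuaternionGroup.card, Nat.card_eq_fintype_card, Fintype.card_fin,
      ← mul_pow]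
    norm_num
  have h2 : Nat.card L.range ∣ 4 := by
    have := Subgroup.card_subgroup_dvd_card L.range
    rwa [Nat.card_eq_fintype_card (α := Multiplicative (ZMod 2 × ZMod 2)),
      show Fintype.card (Multiplicative (ZMod 2 × ZMod 2)) = 4 from rfl] at this
  have h3 : (Finset.univ.filter fun p :
      (Fin d → QuaternionGroup 2) × (Fin d → QuaternionGroup 2) =>
        commutatorDefect φ A B p.1 p.2 = 1 ∨ commutatorDefect φ A B p.1 p.2 = a 2).card =
      Nat.card L.ker := by
    refine (Nat.subtype_card _ fun p => ?_).symm
    rw [Finset.mem_filter, ← toKlein_eq_one_iff]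
    exact and_iff_right (Finset.mem_univ p)
  -- `N` is the index of the image of `L` in the Klein four-group.
  obtain ⟨N, hN⟩ := h2
  rw [h3]
  refine ⟨N, ?_, ?_⟩
  · have : N ∈ Nat.divisors 4 := Nat.mem_divisors.2 ⟨⟨_, by rw [hN, mul_comm]⟩, by norm_num⟩
    rwa [show Nat.divisors 4 = {1, 2, 4} by decide, Finset.mem_insert, Finset.mem_insert,
      Finset.mem_singleton] at this
  · rw [← h1, hN]
    ring

/-- If the ordered product of commutators is central in `Q₈`, then the numbers of pairs of families
for which it takes the two central values differ by `16 ^ d`. -/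
theorem card_commutatorDefect_sub {P : QuaternionGroup 2} (hP : P = 1 ∨ P = a 2)
    (hφ : φ (commutatorProd A B) = MulAut.conj P) :
    ∃ s : ℚ, (s = 1 ∨ s = -1) ∧
      ((Finset.univ.filter fun p : (Fin d → QuaternionGroup 2) × (Fin d → QuaternionGroup 2) =>
        commutatorDefect φ A B p.1 p.2 * P = 1).card : ℚ) -
      (Finset.univ.filter fun p : (Fin d → QuaternionGroup 2) × (Fin d → QuaternionGroup 2) =>
        commutatorDefect φ A B p.1 p.2 * P = a 2).card = s * 16 ^ d := by
  obtain ⟨c, hc, hcg, hsum⟩ := sum_commutatorDefect φ A B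
  have hcentral : ∀ P : QuaternionGroup 2, (P = 1 ∨ P = a 2) → ∀ g, P * g * P⁻¹ = g := by decide
  have hc1 : (c : ℍ[ℚ]) = 1 ∨ (c : ℍ[ℚ]) = -1 := by
    refine eq_one_or_neg_one_of_commute hc fun g => ?_
    have h := hcg g
    rw [hφ, MulAut.conj_apply, hcentral P hP, eq_mul_inv_iff_mul_eq] at h
    exact congrArg Units.val h
  have hcoord : ∀ P : QuaternionGroup 2, (P = 1 ∨ P = a 2) →
      (coord P 0 = 1 ∨ coord P 0 = -1) ∧ ∀ g, coord (g * P) 0 = coord P 0 * coord g 0 := by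
    decide
  obtain ⟨hP0, hPm⟩ := hcoord P hP
  have hre : ∑ p : (Fin d → QuaternionGroup 2) × (Fin d → QuaternionGroup 2),
      (coord (commutatorDefect φ A B p.1 p.2) 0 : ℚ) = 16 ^ d * (c : ℍ[ℚ])⁻¹.re := by
    have h := congrArg QuaternionAlgebra.re hsum
    rw [Quaternion.re_smul, smul_eq_mul, Units.val_inv_eq_inv_val] at h
    rw [← h, Fintype.sum_prod_type]
    have hadd : ∀ (ι : Type) [Fintype ι] (f : ι → ℍ[ℚ]), (∑ i, f i).re = ∑ i, (f i).re :=
      fun ι _ f => map_sum (⟨⟨fun q : ℍ[ℚ] => q.re, rfl⟩, fun _ _ => rfl⟩ : ℍ[ℚ] →+ ℚ) f _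
    simp only [hadd, re_toQuaternion]
  have hcre : (c : ℍ[ℚ])⁻¹.re = 1 ∨ (c : ℍ[ℚ])⁻¹.re = -1 := by
    have hneg : (-1 : ℍ[ℚ])⁻¹ = -1 :=
      inv_eq_of_mul_eq_one_right (by rw [neg_mul_neg, one_mul])
    rcases hc1 with h | h
    · simp [h]
    · simp [h, hneg]
  -- Both `P` and `c` are `±1`; the sign is the product of the real parts of `P` and `c⁻¹`.
  refine ⟨coord P 0 * (c : ℍ[ℚ])⁻¹.re, ?_, ?_⟩
  · rcases hP0 with h | h <;> rcases hcre with h' | h' <;> simp [h, h']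
  · rw [Finset.card_filter, Finset.card_filter, mul_assoc, mul_comm _ ((16 : ℚ) ^ d), ← hre,
      Finset.mul_sum]
    push_cast
    rw [← Finset.sum_sub_distrib]
    refine Finset.sum_congr rfl fun p _ => ?_
    have h := coord_zero_eq (commutatorDefect φ A B p.1 p.2 * P)
    rw [hPm] at h
    exact_mod_cast h.symm

end Count

end QuaternionGroup

/-! ### Lifts in an extension by a normal subgroup -/

namespace GroupExtension

theorem conjAct_inl {N E G : Type*} [Group N] [Group E] [Group G] (S : GroupExtension N E G)
    (n : N) : S.conjAct (S.inl n) = MulAut.conj n := by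
  ext m
  apply S.inl_injective
  rw [S.inl_conjAct_comm, MulAut.conj_apply, map_mul, map_mul, map_inv]

open QuaternionGroup

/-- Every element has a lift that acts on `Q₈` through `signSubgroup`. -/
theorem exists_lift_conjAct_mem {E G : Type*} [Group E] [Group G]
    (S : GroupExtension (QuaternionGroup 2) E G) (g : G) :
    ∃ e, S.rightHom e = g ∧ S.conjAct e ∈ signSubgroup := by
  obtain ⟨e, rfl⟩ := S.rightHom_surjective g
  obtain ⟨x, hx⟩ := exists_conj_mul_mem_signSubgroup (S.conjAct e)
  refine ⟨S.inl x * e, by simp, ?_⟩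
  rwa [map_mul, conjAct_inl]

theorem exists_inl_mul_eq {N E G : Type*} [Group N] [Group E] [Group G]
    (S : GroupExtension N E G) {e e' : E} (h : S.rightHom e = S.rightHom e') :
    ∃ n, S.inl n * e' = e := by
  have : e * e'⁻¹ ∈ S.inl.range := by
    rw [S.range_inl_eq_ker_rightHom, MonoidHom.mem_ker, map_mul, map_inv, h, mul_inv_cancel]
  obtain ⟨n, hn⟩ := this
  exact ⟨n, by rw [hn, inv_mul_cancel_right]⟩

/-- The lifts with trivial product of commutators, in terms of the defect. -/
theorem commutatorLifts_eq_image {N E G : Type*} [Group N] [Group E] [Group G]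
    (S : GroupExtension N E G) {d : ℕ} (A B : Fin d → E) {P : N}
    (hP : S.inl P = commutatorProd A B) :
    commutatorLifts S.rightHom (fun i => S.rightHom (A i)) (fun i => S.rightHom (B i)) =
      (fun p : (Fin d → N) × (Fin d → N) =>
        ((fun i => S.inl (p.1 i) * A i, fun i => S.inl (p.2 i) * B i) :
          (Fin d → E) × (Fin d → E))) ''
      {p | commutatorDefect S.conjAct A B p.1 p.2 * P = 1} := by
  have key : ∀ x y : Fin d → N,
      commutatorProd (fun i => S.inl (x i) * A i) (fun i => S.inl (y i) * B i) =
        S.inl (commutatorDefect S.conjAct A B x y * P) := fun x y => by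
    rw [lift_commutatorDefect S.conjAct S.inl (fun e n => S.inl_conjAct_comm), ← hP, map_mul]
  ext ⟨s, t⟩
  constructor
  · rintro ⟨hs, ht, hst⟩
    choose x hx using fun i => S.exists_inl_mul_eq (hs i)
    choose y hy using fun i => S.exists_inl_mul_eq (ht i)
    obtain rfl : (fun i => S.inl (x i) * A i) = s := funext hx
    obtain rfl : (fun i => S.inl (y i) * B i) = t := funext hy
    refine ⟨(x, y), ?_, rfl⟩
    change commutatorProd _ _ = 1 at hst
    rw [key, map_eq_one_iff _ S.inl_injective] at hst
    exact hst
  · rintro ⟨⟨x, y⟩, h, hxy⟩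
    obtain ⟨rfl, rfl⟩ := Prod.ext_iff.1 hxy
    refine ⟨fun i => by simp, fun i => by simp, ?_⟩
    rw [key, show commutatorDefect S.conjAct A B x y * P = 1 from h, map_one]

theorem injective_inl_mul {N E G : Type*} [Group N] [Group E] [Group G]
    (S : GroupExtension N E G) {d : ℕ} (A B : Fin d → E) :
    Function.Injective (fun p : (Fin d → N) × (Fin d → N) =>
        ((fun i => S.inl (p.1 i) * A i, fun i => S.inl (p.2 i) * B i) :
          (Fin d → E) × (Fin d → E))) := by
  rintro ⟨x, y⟩ ⟨x', y'⟩ h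
  obtain ⟨h1, h2⟩ := Prod.ext_iff.1 h
  refine Prod.ext (funext fun i => ?_) (funext fun i => ?_)
  · exact S.inl_injective (mul_right_cancel (congrFun h1 i))
  · exact S.inl_injective (mul_right_cancel (congrFun h2 i))

end GroupExtension

/-! ### The main theorem -/

open QuaternionGroup in
theorem theorem5 {G' G : Type*} [Group G'] [Group G]
    (S : GroupExtension (QuaternionGroup 2) G' G)
    (d : ℕ) (hd : 2 ≤ d) (α β : Fin d → G) (hαβ : commutatorProd α β = 1) :
    (∃ a b : Fin d → G', (∀ i, S.rightHom (a i) = α i) ∧ (∀ i, S.rightHom (b i) = β i) ∧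
      commutatorProd a b = 1) ∧
    (commutatorLifts S.rightHom α β).Finite ∧
    ∃ N ∈ ({1, 2, 4} : Set ℕ),
      ((commutatorLifts S.rightHom α β).ncard : ℚ) =
          8 ^ (2 * (d : ℤ) - 1) * ((N : ℚ) + 2 ^ (2 - 2 * (d : ℤ))) ∨
      ((commutatorLifts S.rightHom α β).ncard : ℚ) =
          8 ^ (2 * (d : ℤ) - 1) * ((N : ℚ) - 2 ^ (2 - 2 * (d : ℤ))) := by
  choose A hA hA' using fun i => S.exists_lift_conjAct_mem (α i)
  choose B hB hB' using fun i => S.exists_lift_conjAct_mem (β i)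
  obtain rfl : (fun i => S.rightHom (A i)) = α := funext hA
  obtain rfl : (fun i => S.rightHom (B i)) = β := funext hB
  obtain ⟨P, hP⟩ : ∃ P, S.inl P = commutatorProd A B := by
    rw [← map_commutatorProd] at hαβ
    rw [← MonoidHom.mem_range, S.range_inl_eq_ker_rightHom]
    exact hαβ
  have hconj : S.conjAct (commutatorProd A B) = MulAut.conj P := by
    rw [← hP, S.conjAct_inl]
  -- Conjugation by `P` is a product of commutators of elements of `signSubgroup`, which contains no
  -- nontrivial inner automorphism.
  have hP1 : P = 1 ∨ P = a 2 := by
    refine eq_one_or_eq_a_two_of_conj_mem ?_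
    rw [← hconj, map_commutatorProd]
    exact commutatorProd_mem _ hA' hB'
  obtain ⟨N, hN, hcard⟩ := card_commutatorDefect_central S.conjAct A B
  obtain ⟨s, hs, hsub⟩ := card_commutatorDefect_sub S.conjAct A B hP1 hconj
  have hadd : (Finset.univ.filter fun p :
      (Fin d → QuaternionGroup 2) × (Fin d → QuaternionGroup 2) =>
        commutatorDefect S.conjAct A B p.1 p.2 * P = 1).card +
      (Finset.univ.filter fun p : (Fin d → QuaternionGroup 2) × (Fin d → QuaternionGroup 2) =>
        commutatorDefect S.conjAct A B p.1 p.2 * P = a 2).card =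
      (Finset.univ.filter fun p : (Fin d → QuaternionGroup 2) × (Fin d → QuaternionGroup 2) =>
        commutatorDefect S.conjAct A B p.1 p.2 = 1 ∨
          commutatorDefect S.conjAct A B p.1 p.2 = a 2).card := by
    rw [← Finset.card_union_of_disjoint, ← Finset.filter_or]
    · have h : ∀ P : QuaternionGroup 2, (P = 1 ∨ P = a 2) → ∀ g,
          (g * P = 1 ∨ g * P = a 2 ↔ g = 1 ∨ g = a 2) := by decide
      simp only [h P hP1]
    · refine Finset.disjoint_filter.2 fun p _ h1 h2 => ?_
      rw [h1] at h2
      exact absurd h2 (by decide)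
  have hncard : (commutatorLifts S.rightHom (fun i => S.rightHom (A i))
      (fun i => S.rightHom (B i))).ncard = (Finset.univ.filter fun p :
      (Fin d → QuaternionGroup 2) × (Fin d → QuaternionGroup 2) =>
        commutatorDefect S.conjAct A B p.1 p.2 * P = 1).card := by
    rw [S.commutatorLifts_eq_image A B hP, Set.ncard_image_of_injective _ (S.injective_inl_mul A B),
      ← Set.ncard_coe_finset, Finset.coe_filter_univ]
  have hvalue : ((commutatorLifts S.rightHom (fun i => S.rightHom (A i))
      (fun i => S.rightHom (B i))).ncard : ℚ) =
        8 ^ (2 * (d : ℤ) - 1) * ((N : ℚ) + s * 2 ^ (2 - 2 * (d : ℤ))) := by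
    rw [hncard]
    rw [← hadd] at hcard
    have hcard' := congrArg (Nat.cast : ℕ → ℚ) hcard
    push_cast at hcard'
    have e1 : (8 : ℚ) ^ (2 * (d : ℤ) - 1) = 64 ^ d / 8 := by
      rw [zpow_sub₀ (by norm_num), zpow_mul, zpow_natCast]
      norm_num
    have e2 : (2 : ℚ) ^ (2 - 2 * (d : ℤ)) = 4 / 4 ^ d := by
      rw [zpow_sub₀ (by norm_num), zpow_mul, zpow_natCast]
      norm_num
    have e3 : (64 : ℚ) ^ d = 16 ^ d * 4 ^ d := by
      rw [← mul_pow]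
      norm_num
    rw [e1, e2]
    have e4 : (64 : ℚ) ^ d / 8 * (N + s * (4 / 4 ^ d)) = 64 ^ d * N / 8 + s * 16 ^ d / 2 := by
      rw [e3]
      field_simp
      ring
    rw [e4]
    linarith
  have hfin : (commutatorLifts S.rightHom (fun i => S.rightHom (A i))
      (fun i => S.rightHom (B i))).Finite := by
    rw [S.commutatorLifts_eq_image A B hP]
    exact (Set.toFinite _).image _
  refine ⟨?_, hfin, N, hN, ?_⟩
  · have hpos : (0 : ℚ) < (commutatorLifts S.rightHom (fun i => S.rightHom (A i))
        (fun i => S.rightHom (B i))).ncard := by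
      rw [hvalue]
      refine mul_pos (by positivity) ?_
      have hN1 : (1 : ℚ) ≤ N := by
        rcases hN with rfl | rfl | rfl <;> norm_num
      -- Here `d ≥ 2` enters: the correction is smaller than `N`, so lifts exist even with the minus
      -- sign.
      have h2 : (2 : ℚ) ^ (2 - 2 * (d : ℤ)) < 1 :=
        zpow_lt_one_of_neg₀ (by norm_num) (by omega)
      have h3 : (0 : ℚ) < (2 : ℚ) ^ (2 - 2 * (d : ℤ)) := by positivity
      rcases hs with rfl | rfl <;> linarith
    obtain ⟨p, h1, h2, h3⟩ := Set.nonempty_of_ncard_ne_zero (Nat.cast_pos.1 hpos).ne'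
    exact ⟨p.1, p.2, h1, h2, h3⟩
  · rcases hs with rfl | rfl
    · left
      rw [hvalue, one_mul]
    · right
      rw [hvalue, neg_one_mul, ← sub_eq_add_neg]
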